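/- **Setting.** All logarithms are base $2$. For a positive integer $b$ let $\Lambda=\{0,1\}^b$ and let $G:\Lambda\times\Lambda\to\{0,1\}$, $G(s,t)=\sum_{k=1}^b s_kt_k \bmod 2$, be the inner product gadget. For a finite set $J$ and $x,y\in\Lambda^J$ put $G^J(x,y)=(G(x_i,y_i))_{i\in J}\in\{0,1\}^J$. For $0<\delta\le 1$, a random variable $X\in\Lambda^J$ is *$\delta$-dense* if $\Pr[X_I=\alpha]\le 2^{-\delta b|I|}$ for every $I\subseteq J$ and every $\alpha\in\Lambda^I$, where $X_I=(X_i)_{i\in I}$. For $p:\{0,1\}^J\to\mathbb R$ let $\deg(p)$ be the largest $|S|$, $S\subseteq J$, with nonzero Fourier coefficient $\widehat p_S=2^{-|J|}\sum_x p(x)\prod_{i\in S}(-1)^{x_i}$ (and $\deg 0=0$). For $f:\{0,1\}^J\to\{\pm1\}$, the approximate degree $\deg_{\varepsilon}(f)$ is the least $\deg(p)$ over all $p:\{0,1\}^J\to\mathbb R$ with $|f(z)-p(z)|\le\varepsilon$ for all $z$. For finite sets $\mathcal X,\mathcal Y$, a $t$-round quantum protocol with prior entanglement has state space $H_A\otimes\mathbb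 C^2\otimes H_B$ with finite-dimensional $H_A,H_B$, each containing a register for that player's input. On input $(x,y)$ it starts in $\sum_w\alpha_w|x,w\rangle|0\rangle|y,w\rangle$, where $\sum_w|\alpha_w|^2=1$. Alice and Bob alternate (either one may start); in a round, the active player applies a fixed unitary to his or her own space together with the channel $\mathbb C^2$. After $t$ rounds the protocol outputs $-1$ with probability equal to the squared norm of the projection of the state onto $H_A\otimes|1\rangle\otimes H_B$, and $1$ otherwise. Its cost is $t$. For $F:\mathcal X\times\mathcal Y\to\{\pm1\}$, $Q^*_\varepsilon(F)$ is the least cost of such a protocol that, on every input $(x,y)$, outputs $F(x,y)$ with probability at least $1-\varepsilon$. **Theorem.** There are an absolute constant $c>0$ and an integer $n_0$ such that the following holds for every $n\ge n_0$ and $b=20\log n$ (rounded up or down to an integer). Let $J\subseteq[n]$, let $\ell\ge0$ be any integer, and let $U,V\subseteq\Lambda^J\times\{0,1\}^\ell$ be nonempty. Let $(X,A)$ be uniformly distributed over $U$ and $(Y,B)$ uniformly distributed over $V$, where $X,Y\in\Lambda^J$. Let $f:\{0,1\}^J\to\{\pm1\}$ be any function and define $F:U\times V\to\{\pm1\}$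 by $$F(u,v)=f(G^J(x,y)),\qquad u=(x,a)\in U,\ v=(y,a')\in V.$$ If $X$ and $Y$ are both $0.99$-dense, then $$Q^*_{0.1}(F)\ \ge\ c\cdot\deg_{1/3}(f)\cdot b .$$ -/

import Mathlib

namespace DenseLift

/-! ### Fourier expansion and approximate degree on `{0,1}^ι` (bits are elements of `ZMod 2`) -/

/-- The character `χ_S(x) = ∏_{i ∈ S} (-1)^{x_i}`. -/
def chi {ι : Type*} (S : Finset ι) (x : ι → ZMod 2) : ℝ :=
  ∏ i ∈ S, (-1 : ℝ) ^ (x i).val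

/-- The Fourier coefficient `2^{-|ι|} ∑_x p(x) χ_S(x)`. -/
noncomputable def cubeFourierCoeff {ι : Type*} [Fintype ι] [DecidableEq ι]
    (p : (ι → ZMod 2) → ℝ) (S : Finset ι) : ℝ :=
  ((2 : ℝ) ^ Fintype.card ι)⁻¹ * ∑ x : ι → ZMod 2, p x * chi S x

open Classical in
/-- The degree of `p`: the largest size of a set `S` whose Fourier coefficient is nonzero
(and `0` for the zero function). -/
noncomputable def fourierDegree {ι : Type*} [Fintype ι] [DecidableEq ι]
    (p : (ι → ZMod 2) → ℝ) : ℕ :=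
  (Finset.univ.filter fun S : Finset ι => cubeFourierCoeff p S ≠ 0).sup Finset.card

/-- The `ε`-approximate degree of `f`: the smallest degree of a real function `p` with
`|f(x) - p(x)| ≤ ε` for all `x`. -/
noncomputable def approxDegree {ι : Type*} [Fintype ι] [DecidableEq ι]
    (ε : ℝ) (f : (ι → ZMod 2) → ℝ) : ℕ :=
  sInf {d : ℕ | ∃ p : (ι → ZMod 2) → ℝ, (∀ x, |f x - p x| ≤ ε) ∧ fourierDegree p = d}

/-! ### Gadget and density -/

/-- The alphabet `Λ = {0,1}^b`. -/
abbrev Block (b : ℕ) : Type := Fin b → ZMod 2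

/-- `G^ι(x, y)`: the inner product mod 2, applied in every coordinate. -/
def innerGadget {ι : Type*} {b : ℕ} (x y : ι → Block b) : ι → ZMod 2 :=
  fun i => ∑ k : Fin b, x i k * y i k

/-- A random variable in `Λ^ι` with law `D` is `δ`-dense: for every set `I` of coordinates, each
value of the projection to `I` has probability at most `2^{-δ b |I|}`. -/
def IsDense {ι : Type*} {b : ℕ} (δ : ℝ) (D : PMF (ι → Block b)) : Prop :=
  ∀ (I : Finset ι) (α : I → Block b),
    ((D.map fun (x : ι → Block b) (i : I) => x i) α).toReal ≤
      (2 : ℝ) ^ (-(δ * (b : ℝ) * (I.card : ℝ)))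

/-- The law of `X` when `(X, A)` is uniformly distributed over the nonempty finite set `U`. -/
noncomputable def uniformFst {α β : Type*} (U : Finset (α × β)) (hU : U.Nonempty) : PMF α :=
  (PMF.uniformOfFinset U hU).map Prod.fst

/-- `F(u, v) = f(G^ι(x, y))` for `u = (x, a) ∈ U` and `v = (y, a') ∈ V`. -/
def composedOn {ι A B : Type*} {b : ℕ} (f : (ι → ZMod 2) → ℤˣ)
    (U : Finset ((ι → Block b) × A)) (V : Finset ((ι → Block b) × B)) : U → V → ℤˣ :=
  fun u v => f (innerGadget u.1.1 v.1.1)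

/-! ### Two-party quantum communication with prior entanglement -/

/-- A quantum protocol with prior entanglement for inputs in `X × Y`.  The state space is
`H_A ⊗ ℂ² ⊗ H_B`, where `H_A = ℂ^X ⊗ ℂ^dim` holds Alice's input register and her workspace,
`H_B = ℂ^Y ⊗ ℂ^dim` likewise for Bob, and the factor `ℂ²` is the one-qubit channel.
(Using the same workspace dimension on both sides is no restriction: pad the smaller one.)
The two parties speak alternately; in round `i` the speaker applies the unitary with index `i`
to its own space and the channel.  Only the first `rounds` indices are used. -/
structure QProtocol (X Y : Type*) [Fintype X] [DecidableEq X] [Fintype Y] [DecidableEq Y] where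
  /-- The communication cost. -/
  rounds : ℕ
  /-- Whether Alice speaks first. -/
  aliceFirst : Bool
  /-- The dimension of each workspace. -/
  dim : ℕ
  /-- The amplitudes of the shared entangled state. -/
  amp : Fin dim → ℂ
  amp_normalized : ∑ w, ‖amp w‖ ^ 2 = 1
  /-- Alice's unitaries on `H_A ⊗ ℂ²`. -/
  alice : ℕ → Matrix.unitaryGroup ((X × Fin dim) × Fin 2) ℂ
  /-- Bob's unitaries on `ℂ² ⊗ H_B`. -/
  bob : ℕ → Matrix.unitaryGroup (Fin 2 × (Y × Fin dim)) ℂ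

namespace QProtocol

variable {X Y : Type*} [Fintype X] [DecidableEq X] [Fintype Y] [DecidableEq Y]

/-- Coordinate vectors of elements of `H_A ⊗ ℂ² ⊗ H_B`. -/
abbrev State (P : QProtocol X Y) : Type _ :=
  (X × Fin P.dim) → Fin 2 → (Y × Fin P.dim) → ℂ

/-- The initial state `∑_w α_w |x,w⟩ |0⟩ |y,w⟩`. -/
def initial (P : QProtocol X Y) (x : X) (y : Y) : P.State :=
  fun r q s => if r.1 = x ∧ q = 0 ∧ s.1 = y ∧ r.2 = s.2 then P.amp r.2 else 0

/-- Whether Alice speaks in round `i` (rounds are numbered from `0`). -/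
def aliceTurn (P : QProtocol X Y) (i : ℕ) : Prop :=
  if P.aliceFirst then Even i else Odd i

/-- The operator `M ⊗ I_{H_B}`. -/
def applyAlice (P : QProtocol X Y)
    (M : Matrix ((X × Fin P.dim) × Fin 2) ((X × Fin P.dim) × Fin 2) ℂ) (φ : P.State) : P.State :=
  fun r q s => ∑ r', ∑ q', M (r, q) (r', q') * φ r' q' s

/-- The operator `I_{H_A} ⊗ M`. -/
def applyBob (P : QProtocol X Y)
    (M : Matrix (Fin 2 × (Y × Fin P.dim)) (Fin 2 × (Y × Fin P.dim)) ℂ) (φ : P.State) : P.State :=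
  fun r q s => ∑ q', ∑ s', M (q, s) (q', s') * φ r q' s'

open Classical in
/-- The state on input `(x, y)` after the first `i` rounds. -/
noncomputable def stateAfter (P : QProtocol X Y) (x : X) (y : Y) : ℕ → P.State
  | 0 => P.initial x y
  | i + 1 =>
    if P.aliceTurn i then P.applyAlice (P.alice i).1 (P.stateAfter x y i)
    else P.applyBob (P.bob i).1 (P.stateAfter x y i)

/-- The probability of output `-1`: the squared length of the projection of the final state
onto `H_A ⊗ |1⟩ ⊗ H_B`. -/
noncomputable def probNegOne (P : QProtocol X Y) (x : X) (y : Y) : ℝ :=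
  ∑ r, ∑ s, ‖P.stateAfter x y P.rounds r 1 s‖ ^ 2

/-- The probability of output `σ ∈ {1, -1}`. -/
noncomputable def outputProb (P : QProtocol X Y) (x : X) (y : Y) (σ : ℤˣ) : ℝ :=
  if σ = -1 then P.probNegOne x y else 1 - P.probNegOne x y

/-- The protocol computes `F` with error `ε`. -/
def Computes (P : QProtocol X Y) (F : X → Y → ℤˣ) (ε : ℝ) : Prop :=
  ∀ x y, 1 - ε ≤ P.outputProb x y (F x y)

end QProtocol

/-- `Q*_ε(F)`: the least cost of a quantum protocol with prior entanglement that computes `F`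
with error `ε`. -/
noncomputable def quantumCC {X Y : Type*} [Fintype X] [DecidableEq X] [Fintype Y] [DecidableEq Y]
    (ε : ℝ) (F : X → Y → ℤˣ) : ℕ∞ :=
  ⨅ (P : QProtocol X Y) (_ : P.Computes F ε), (P.rounds : ℕ∞)

end DenseLift

/-! The proof is generalized discrepancy with a dual polynomial. Let `d` be the 1/3-approximate
degree of `f`, assumed positive. Duality (`exists_dual_polynomial`) gives a nonzero ψ orthogonal to
all characters of level below `d`, with ⟨ψ, f⟩ ≥ 0.33‖ψ‖₁. The witness matrix is ψ(G^J(x,y)) on U ×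
V.

Upper bound: the acceptance matrix of a t-round protocol is a sum of 4^t matrices of inner products
of vectors of length at most one (`exists_probNegOne_eq_sum`). A character χ_S of the gadget outputs
is a Hadamard matrix in (x_S, y_S), so Lindsey's lemma and density bound its normalized correlation
with each such matrix by 2^{b|S|/2} · 2^{-0.99b|S|} = r^|S|, where r = 2^{-0.49b}. Only levels |S| ≥
d of ψ survive, and n·r ≤ 2^{-0.43b} absorbs the number of sets S (`sum_pow_card_le`). The
protocol's correlation with ψ is thus O(4^t (nr)^d)‖ψ‖₁.

Lower bound: the all-ones matrix is also of this kind, so G^J(X,Y) is nearly uniform and ⟨ψ, f⟩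
survives the passage to U × V. An error of 0.1 then costs only about 0.2‖ψ‖₁ of the correlation.
Comparing the two bounds gives t = Ω(bd). -/

namespace DenseLift

/-! ### Fourier analysis on the cube and the dual polynomial. -/

theorem eq_zero_or_one : ∀ a : ZMod 2, a = 0 ∨ a = 1 := by decide

theorem val_one_zmod_two : (1 : ZMod 2).val = 1 := rfl

theorem neg_one_pow_val_add (a b : ZMod 2) :
    (-1 : ℝ) ^ (a + b).val = (-1) ^ a.val * (-1) ^ b.val := by
  rcases eq_zero_or_one a with rfl | rfl <;> rcases eq_zero_or_one b with rfl | rfl <;>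
    simp [val_one_zmod_two, show (1 + 1 : ZMod 2) = 0 from rfl]

theorem neg_one_pow_val_sum {κ : Type*} (s : Finset κ) (g : κ → ZMod 2) :
    (-1 : ℝ) ^ (∑ k ∈ s, g k).val = ∏ k ∈ s, (-1) ^ (g k).val := by
  classical
  induction s using Finset.induction_on with
  | empty => simp
  | insert k s hk ih => rw [Finset.sum_insert hk, neg_one_pow_val_add, ih, Finset.prod_insert hk]

theorem sum_neg_one_pow_val : ∑ a : ZMod 2, (-1 : ℝ) ^ a.val = 0 := by
  rw [show (Finset.univ : Finset (ZMod 2)) = {0, 1} from rfl, Finset.sum_pair zero_ne_one]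
  simp [val_one_zmod_two]

theorem sum_neg_one_pow_val_mul (a a' : ZMod 2) :
    ∑ c : ZMod 2, (-1 : ℝ) ^ (a * c).val * (-1) ^ (a' * c).val = if a = a' then 2 else 0 := by
  rw [show (Finset.univ : Finset (ZMod 2)) = {0, 1} from rfl, Finset.sum_pair zero_ne_one]
  rcases eq_zero_or_one a with rfl | rfl <;> rcases eq_zero_or_one a' with rfl | rfl <;>
    simp [val_one_zmod_two] <;> norm_num

theorem abs_chi {ι : Type*} (S : Finset ι) (x : ι → ZMod 2) : |chi S x| = 1 := by
  simp [chi, Finset.abs_prod, abs_pow]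

theorem prod_ite_eq_pow {κ R : Type*} [Fintype κ] [CommSemiring R] [DecidableEq R]
    {β : κ → Type*} [∀ k, DecidableEq (β k)] (x y : ∀ k, β k) (r : R) :
    ∏ k, (if x k = y k then r else 0) = if x = y then r ^ Fintype.card κ else 0 := by
  classical
  split_ifs with h
  · subst h; simp
  · obtain ⟨k, hk⟩ := Function.ne_iff.mp h
    exact Finset.prod_eq_zero (Finset.mem_univ k) (by simp [hk])

section Cube

variable {ι : Type*} [Fintype ι]

theorem sum_finset_chi_mul_chi (x y : ι → ZMod 2) :
    ∑ S : Finset ι, chi S x * chi S y = if x = y then (2 : ℝ) ^ Fintype.card ι else 0 := by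
  simp only [chi, ← Finset.prod_mul_distrib]
  rw [← Finset.powerset_univ, ← Finset.prod_one_add, ← prod_ite_eq_pow]
  refine Finset.prod_congr rfl fun i _ => ?_
  generalize x i = a
  generalize y i = c
  rcases eq_zero_or_one a with rfl | rfl <;> rcases eq_zero_or_one c with rfl | rfl <;>
    simp [val_one_zmod_two] <;> norm_num

variable [DecidableEq ι]

/-- Writing both characters over all of `ι` turns a sum over the cube into a product of one-bit
sums. -/
theorem chi_mul_chi (S T : Finset ι) (x : ι → ZMod 2) :
    chi S x * chi T x =
      ∏ i, ((if i ∈ S then (-1) ^ (x i).val else 1) * (if i ∈ T then (-1) ^ (x i).val else 1)) := by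
  rw [Finset.prod_mul_distrib, Finset.prod_ite_mem, Finset.prod_ite_mem]
  simp [chi]

theorem sum_chi_mul_chi_of_ne {S T : Finset ι} (h : S ≠ T) :
    ∑ x : ι → ZMod 2, chi S x * chi T x = 0 := by
  simp only [chi_mul_chi]
  rw [← Fintype.prod_sum fun (i : ι) (a : ZMod 2) =>
    ((if i ∈ S then (-1 : ℝ) ^ a.val else 1) * (if i ∈ T then (-1) ^ a.val else 1))]
  obtain ⟨i, hi⟩ : ∃ i, ¬(i ∈ S ↔ i ∈ T) := by
    by_contra! hcon
    exact h (Finset.ext hcon)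
  refine Finset.prod_eq_zero (Finset.mem_univ i) ?_
  by_cases hS : i ∈ S <;> by_cases hT : i ∈ T
  · simp [hS, hT] at hi
  · simp [hS, hT, sum_neg_one_pow_val]
  · simp [hS, hT, sum_neg_one_pow_val]
  · simp [hS, hT] at hi

/-- Fourier inversion on the cube. -/
theorem sum_chi_mul_sum (g : (ι → ZMod 2) → ℝ) (z : ι → ZMod 2) :
    ∑ S : Finset ι, (∑ x, g x * chi S x) * chi S z = 2 ^ Fintype.card ι * g z := by
  simp only [Finset.sum_mul, mul_assoc]
  rw [Finset.sum_comm]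
  simp only [← Finset.mul_sum, sum_finset_chi_mul_chi]
  simp [mul_comm]

/-- The functions whose Fourier coefficients of level at least `d` vanish. -/
noncomputable def lowDegree (ι : Type*) [Fintype ι] [DecidableEq ι] (d : ℕ) :
    Submodule ℝ ((ι → ZMod 2) → ℝ) where
  carrier := {p | ∀ S : Finset ι, d ≤ S.card → ∑ x, p x * chi S x = 0}
  zero_mem' := by simp
  add_mem' := by
    intro p q hp hq S hS
    simp [add_mul, Finset.sum_add_distrib, hp S hS, hq S hS]
  smul_mem' := by
    intro c p hp S hS
    simp [mul_assoc, ← Finset.mul_sum, hp S hS]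

theorem chi_mem_lowDegree {d : ℕ} {S : Finset ι} (hS : S.card < d) : chi S ∈ lowDegree ι d := by
  intro T hT
  exact sum_chi_mul_chi_of_ne (by rintro rfl; omega)

theorem fourierDegree_lt_of_mem_lowDegree {d : ℕ} (hd : 0 < d) {p : (ι → ZMod 2) → ℝ}
    (hp : p ∈ lowDegree ι d) : fourierDegree p < d := by
  rw [fourierDegree, Finset.sup_lt_iff (by simpa using hd)]
  intro S hS
  by_contra! hcon
  simp [cubeFourierCoeff, hp S hcon] at hS

/-- Linear programming duality for the approximate degree. -/
theorem exists_dual_polynomial {ε r : ℝ} (hrε : r < ε) (hr : 0 ≤ r) (f : (ι → ZMod 2) → ℝ)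
    (hd : 0 < approxDegree ε f) :
    ∃ ψ : (ι → ZMod 2) → ℝ, (∀ S : Finset ι, S.card < approxDegree ε f → ∑ z, ψ z * chi S z = 0) ∧
      0 < ∑ z, |ψ z| ∧ r * ∑ z, |ψ z| ≤ ∑ z, ψ z * f z := by
  set d := approxDegree ε f with hd'
  have hε : 0 < ε := hr.trans_lt hrε
  -- Functions are normed by the sup norm, so the ball consists of ε-approximants of `f`; one in the
  -- subspace would have degree below `d`.
  have hdisj : Disjoint (Metric.ball f ε) (lowDegree ι d : Set ((ι → ZMod 2) → ℝ)) := by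
    rw [Set.disjoint_left]
    intro p hp hpd
    have hlt := fourierDegree_lt_of_mem_lowDegree hd hpd
    have hle : d ≤ fourierDegree p := by
      refine Nat.sInf_le ⟨p, fun x => ?_, rfl⟩
      rw [Metric.mem_ball, dist_comm] at hp
      exact (dist_le_pi_dist f p x).trans hp.le
    omega
  obtain ⟨φ, u, hφ, hu⟩ := geometric_hahn_banach_open (convex_ball f ε) Metric.isOpen_ball
    (lowDegree ι d).convex hdisj
  have hu0 : u ≤ 0 := by simpa using hu 0 (lowDegree ι d).zero_mem
  -- A linear functional bounded below on a subspace vanishes there: otherwise some multiple of `p`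
  -- takes the value `u - 1`.
  have hvan : ∀ p ∈ lowDegree ι d, φ p = 0 := by
    intro p hp
    by_contra hne
    have := hu (((u - 1) / φ p) • p) ((lowDegree ι d).smul_mem _ hp)
    rw [map_smul, smul_eq_mul, div_mul_cancel₀ _ hne] at this
    linarith
  have hrep : ∀ g : (ι → ZMod 2) → ℝ, φ g = ∑ z, φ (Pi.single z 1) * g z := by
    intro g
    conv_lhs => rw [← Finset.univ_sum_single g]
    rw [map_sum]
    refine Finset.sum_congr rfl fun z _ => ?_
    rw [show Pi.single z (g z) = g z • (Pi.single z (1 : ℝ) : (ι → ZMod 2) → ℝ) by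
      rw [← Pi.single_smul, smul_eq_mul, mul_one], map_smul, smul_eq_mul, mul_comm]
  have hneg : ∀ g ∈ Metric.ball f ε, φ g < 0 := fun g hg => (hφ g hg).trans_le hu0
  refine ⟨fun z => -φ (Pi.single z 1), fun S hS => ?_, ?_, ?_⟩
  · have := hvan _ (chi_mem_lowDegree hS)
    rw [hrep] at this
    simpa using this
  · refine lt_of_le_of_ne (Finset.sum_nonneg fun _ _ => abs_nonneg _) fun h0 => ?_
    have h1 := (Finset.sum_eq_zero_iff_of_nonneg fun _ _ => abs_nonneg _).mp h0.symm
    have h2 := hneg f (Metric.mem_ball_self hε)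
    rw [hrep] at h2
    refine h2.ne (Finset.sum_eq_zero fun z hz => ?_)
    have := h1 z hz
    simp only [abs_neg, abs_eq_zero] at this
    rw [this, zero_mul]
  -- Moving `f` by `r` in the direction of the signs of φ stays in the open ball because `r < ε`;
  -- negativity of φ at this point is exactly the correlation bound.
  · have hg : (fun z => f z + r * SignType.sign (φ (Pi.single z 1))) ∈ Metric.ball f ε := by
      rw [Metric.mem_ball]
      refine lt_of_le_of_lt ((dist_pi_le_iff hr).mpr fun z => ?_) hrε
      rw [Real.dist_eq, add_sub_cancel_left, abs_mul, abs_of_nonneg hr]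
      refine mul_le_of_le_one_right hr ?_
      rcases lt_trichotomy (φ (Pi.single z 1)) 0 with h | h | h <;> simp [h]
    have h3 := hneg _ hg
    rw [hrep] at h3
    simp only [mul_add, Finset.sum_add_distrib] at h3
    have h4 : ∑ z, φ (Pi.single z 1) * (r * (SignType.sign (φ (Pi.single z 1)) : ℝ)) =
        r * ∑ z, |φ (Pi.single z 1)| := by
      rw [Finset.mul_sum]
      refine Finset.sum_congr rfl fun z _ => ?_
      rw [mul_left_comm, self_mul_sign]
    simp only [abs_neg, neg_mul, Finset.sum_neg_distrib]
    linarith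

end Cube

/-! ### Hadamard matrices, Lindsey's lemma and correlation with gadget characters. -/

/-- The Hadamard matrix with rows and columns indexed by tuples of blocks. -/
noncomputable def hadamard {κ : Type*} [Fintype κ] {b : ℕ} (x y : κ → Block b) : ℝ :=
  ∏ i, ∏ k, (-1 : ℝ) ^ (x i k * y i k).val

theorem chi_innerGadget {ι : Type*} {b : ℕ} (S : Finset ι) (x y : ι → Block b) :
    chi S (innerGadget x y) = hadamard (fun i : S => x i) (fun i : S => y i) := by
  simp only [chi, innerGadget, hadamard, neg_one_pow_val_sum]
  exact (Finset.prod_coe_sort S fun i => ∏ k, (-1 : ℝ) ^ (x i k * y i k).val).symm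

section Hadamard

variable {κ : Type*} [Fintype κ] [DecidableEq κ] {b : ℕ}

theorem sum_hadamard_mul_hadamard (x x' : κ → Block b) :
    ∑ y, hadamard x y * hadamard x' y = if x = x' then (2 : ℝ) ^ (b * Fintype.card κ) else 0 := by
  simp only [hadamard, ← Finset.prod_mul_distrib]
  rw [← Fintype.prod_sum fun (i : κ) (c : Block b) =>
    ∏ k, (-1 : ℝ) ^ (x i k * c k).val * (-1) ^ (x' i k * c k).val]
  have h : ∀ i, ∑ c : Block b, ∏ k, (-1 : ℝ) ^ (x i k * c k).val * (-1) ^ (x' i k * c k).val =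
      if x i = x' i then 2 ^ b else 0 := by
    intro i
    rw [← Fintype.prod_sum fun (k : Fin b) (a : ZMod 2) =>
      (-1 : ℝ) ^ (x i k * a).val * (-1) ^ (x' i k * a).val]
    simp only [sum_neg_one_pow_val_mul, prod_ite_eq_pow, Fintype.card_fin]
  simp only [h, prod_ite_eq_pow, pow_mul]

/-- Parseval: the rows of the Hadamard matrix are orthogonal, each of squared length `2 ^ (b *
|κ|)`. -/
theorem sum_norm_sq_hadamard_transform (F : (κ → Block b) → ℂ) :
    ∑ y, ‖∑ x, (hadamard x y : ℂ) * F x‖ ^ 2 = 2 ^ (b * Fintype.card κ) * ∑ x, ‖F x‖ ^ 2 := by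
  apply Complex.ofReal_injective
  push_cast
  simp only [← Complex.mul_conj', map_sum, map_mul, Complex.conj_ofReal, Finset.sum_mul_sum]
  rw [Finset.sum_comm]
  rw [Finset.mul_sum]
  refine Finset.sum_congr rfl fun x _ => ?_
  rw [Finset.sum_comm]
  have h : ∀ x', ∑ y, (hadamard x y : ℂ) * F x * (hadamard x' y * (starRingEnd ℂ) (F x')) =
      (if x = x' then (2 : ℂ) ^ (b * Fintype.card κ) else 0) * (F x * (starRingEnd ℂ) (F x')) := by
    intro x'
    have := congrArg Complex.ofReal (sum_hadamard_mul_hadamard x x')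
    push_cast at this
    rw [apply_ite Complex.ofReal] at this
    push_cast at this
    rw [← this, Finset.sum_mul]
    exact Finset.sum_congr rfl fun y _ => by ring
  simp [h]

end Hadamard

theorem norm_sum_mul_sq_le {κ : Type*} (s : Finset κ) (f g : κ → ℂ) :
    ‖∑ i ∈ s, f i * g i‖ ^ 2 ≤ (∑ i ∈ s, ‖f i‖ ^ 2) * ∑ i ∈ s, ‖g i‖ ^ 2 := by
  refine le_trans ?_ (Finset.sum_mul_sq_le_sq_mul_sq s (fun i => ‖f i‖) fun i => ‖g i‖)
  gcongr
  exact (norm_sum_le _ _).trans_eq (Finset.sum_congr rfl fun _ _ => norm_mul _ _)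

/-- Lindsey's lemma for vector-valued functions. -/
theorem norm_hadamard_bilinear_sq_le {κ K : Type*} [Fintype κ] [DecidableEq κ] [Fintype K] {b : ℕ}
    (F G : (κ → Block b) → K → ℂ) :
    ‖∑ x, ∑ y, (hadamard x y : ℂ) * ∑ k, F x k * G y k‖ ^ 2 ≤
      2 ^ (b * Fintype.card κ) * (∑ x, ∑ k, ‖F x k‖ ^ 2) * ∑ y, ∑ k, ‖G y k‖ ^ 2 := by
  -- Pairing the index `k` with `y` leaves one Cauchy–Schwarz inequality, so the bound does not
  -- depend on the dimension of the vectors.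
  have h : ∑ x, ∑ y, (hadamard x y : ℂ) * ∑ k, F x k * G y k =
      ∑ p : (κ → Block b) × K, (∑ x, (hadamard x p.1 : ℂ) * F x p.2) * G p.1 p.2 := by
    rw [Fintype.sum_prod_type, Finset.sum_comm]
    refine Finset.sum_congr rfl fun y _ => ?_
    simp only [Finset.mul_sum, Finset.sum_mul]
    rw [Finset.sum_comm]
    simp only [mul_assoc]
  rw [h]
  refine (norm_sum_mul_sq_le _ _ _).trans_eq ?_
  rw [Fintype.sum_prod_type, Fintype.sum_prod_type, Finset.sum_comm (f := fun y k =>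
    ‖∑ x, (hadamard x y : ℂ) * F x k‖ ^ 2)]
  simp only [sum_norm_sq_hadamard_transform, ← Finset.mul_sum]
  rw [Finset.sum_comm (f := fun k x => ‖F x k‖ ^ 2)]

/-- Averages of unit vectors over the fibres of `π`, when no fibre is large. -/
theorem sum_norm_sq_fiber_sum_le {α γ K : Type*} [Fintype α] [Fintype γ] [DecidableEq γ] [Fintype K]
    (π : α → γ) {ρ : ℝ} (hρ : ∀ c, ((Finset.univ.filter fun u => π u = c).card : ℝ) ≤
      ρ * Fintype.card α) (a : α → K → ℂ) (ha : ∀ u, ∑ k, ‖a u k‖ ^ 2 ≤ 1) :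
    ∑ c, ∑ k, ‖∑ u with π u = c, a u k‖ ^ 2 ≤ ρ * (Fintype.card α : ℝ) ^ 2 := by
  -- A sum of vectors of length at most one over a fibre has squared length at most |fibre|²; one
  -- factor is bounded by the fibre hypothesis, and the other sums to `|α|`.
  have h1 : ∀ c, ∑ k, ‖∑ u with π u = c, a u k‖ ^ 2 ≤
      (ρ * Fintype.card α) * ((Finset.univ.filter fun u => π u = c).card : ℝ) := by
    intro c
    have h2 : ∀ k, ‖∑ u with π u = c, a u k‖ ^ 2 ≤
        ((Finset.univ.filter fun u => π u = c).card : ℝ) * ∑ u with π u = c, ‖a u k‖ ^ 2 := by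
      intro k
      simpa using norm_sum_mul_sq_le (Finset.univ.filter fun u => π u = c) (fun _ => 1)
        fun u => a u k
    calc _ ≤ ∑ k, ((Finset.univ.filter fun u => π u = c).card : ℝ) *
          ∑ u with π u = c, ‖a u k‖ ^ 2 := Finset.sum_le_sum fun k _ => h2 k
      _ = ((Finset.univ.filter fun u => π u = c).card : ℝ) *
          ∑ u with π u = c, ∑ k, ‖a u k‖ ^ 2 := by rw [← Finset.mul_sum, Finset.sum_comm]
      _ ≤ (ρ * Fintype.card α) * ((Finset.univ.filter fun u => π u = c).card : ℝ) := by
          refine mul_le_mul (hρ c) ?_ (by positivity) ((Nat.cast_nonneg _).trans (hρ c))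
          exact (Finset.sum_le_card_nsmul _ _ 1 fun u _ => ha u).trans_eq (by simp)
  refine (Finset.sum_le_sum fun c _ => h1 c).trans_eq ?_
  rw [← Finset.mul_sum, ← Nat.cast_sum, Finset.sum_card_fiberwise_eq_card_filter]
  simp
  ring

/-- Correlation of a character of the gadget outputs with a matrix of small factorization norm. -/
theorem norm_sum_chi_innerGadget_le {ι α β K : Type*} [Fintype α] [Fintype β] [DecidableEq ι]
    [Fintype K] {b : ℕ} (S : Finset ι) (x : α → ι → Block b) (y : β → ι → Block b) {ρ : ℝ}
    (hρ0 : 0 ≤ ρ)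
    (hx : ∀ c : S → Block b, ((Finset.univ.filter fun u => (fun i : S => x u i) = c).card : ℝ) ≤
      ρ * Fintype.card α)
    (hy : ∀ c : S → Block b, ((Finset.univ.filter fun v => (fun i : S => y v i) = c).card : ℝ) ≤
      ρ * Fintype.card β)
    (a : α → K → ℂ) (ha : ∀ u, ∑ k, ‖a u k‖ ^ 2 ≤ 1)
    (c : β → K → ℂ) (hc : ∀ v, ∑ k, ‖c v k‖ ^ 2 ≤ 1) :
    ‖∑ u, ∑ v, (chi S (innerGadget (x u) (y v)) : ℂ) * ∑ k, a u k * c v k‖ ^ 2 ≤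
      2 ^ (b * S.card) * (ρ * Fintype.card α * Fintype.card β) ^ 2 := by
  -- The character depends only on the blocks in `S`, so the vectors can be summed over the fibres
  -- of the projections before Lindsey's lemma is applied.
  have h : ∑ u, ∑ v, (chi S (innerGadget (x u) (y v)) : ℂ) * ∑ k, a u k * c v k =
      ∑ s : S → Block b, ∑ t : S → Block b, (hadamard s t : ℂ) *
        ∑ k, (∑ u with (fun i : S => x u i) = s, a u k) *
          ∑ v with (fun i : S => y v i) = t, c v k := by
    simp only [chi_innerGadget]
    rw [← Finset.sum_fiberwise Finset.univ (fun u (i : S) => x u i)]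
    refine Finset.sum_congr rfl fun s _ => ?_
    rw [Finset.sum_comm, ← Finset.sum_fiberwise Finset.univ (fun v (i : S) => y v i)]
    refine Finset.sum_congr rfl fun t _ => ?_
    simp only [Finset.sum_mul_sum]
    rw [Finset.sum_comm (s := Finset.univ), Finset.mul_sum, Finset.sum_comm]
    refine Finset.sum_congr rfl fun u hu => ?_
    rw [Finset.sum_comm, Finset.mul_sum]
    refine Finset.sum_congr rfl fun v hv => ?_
    rw [(Finset.mem_filter.mp hu).2, (Finset.mem_filter.mp hv).2]
  rw [h]
  refine (norm_hadamard_bilinear_sq_le _ _).trans ?_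
  rw [Fintype.card_coe, mul_assoc]
  refine mul_le_mul_of_nonneg_left ?_ (by positivity)
  refine (mul_le_mul (sum_norm_sq_fiber_sum_le _ hx a ha) (sum_norm_sq_fiber_sum_le _ hy c hc)
    (by positivity) (by positivity)).trans_eq ?_
  ring

/-! ### Contractions in the operator norm. -/

section Contraction

open scoped Matrix.Norms.L2Operator Matrix

variable {m n : Type*} [Fintype m] [Fintype n] [DecidableEq n]

theorem l2_opNorm_one_le : ‖(1 : Matrix n n ℂ)‖ ≤ 1 := by
  rcases isEmpty_or_nonempty n with h | h
  · rw [Subsingleton.elim (1 : Matrix n n ℂ) 0, norm_zero]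
    exact zero_le_one
  · exact CStarRing.norm_one.le

theorem l2_opNorm_le_one_of_conjTranspose_mul_self {M : Matrix m n ℂ} (h : Mᴴ * M = 1) :
    ‖M‖ ≤ 1 := by
  have h1 := Matrix.l2_opNorm_conjTranspose_mul_self M
  rw [h] at h1
  nlinarith [l2_opNorm_one_le (n := n), norm_nonneg M]

theorem l2_opNorm_inclusion_le [DecidableEq m] {g : n → m} (hg : Function.Injective g) :
    ‖(1 : Matrix m m ℂ).submatrix id g‖ ≤ 1 := by
  refine l2_opNorm_le_one_of_conjTranspose_mul_self ?_
  rw [Matrix.conjTranspose_submatrix, Matrix.conjTranspose_one, ← Matrix.submatrix_mul _ _ _ _ _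
    Function.bijective_id, Matrix.one_mul, Matrix.submatrix_one _ hg]

theorem l2_opNorm_mul_le_one {k : Type*} [Fintype k] [DecidableEq k] {M : Matrix m n ℂ}
    {N : Matrix n k ℂ} (hM : ‖M‖ ≤ 1) (hN : ‖N‖ ≤ 1) : ‖M * N‖ ≤ 1 :=
  (Matrix.l2_opNorm_mul M N).trans (mul_le_one₀ hM (norm_nonneg _) hN)

/-- A block of a unitary is the unitary compressed between two coordinate inclusions, each a
contraction. -/
theorem l2_opNorm_submatrix_unitary_le [DecidableEq m] {k : Type*} [Fintype k] [DecidableEq k]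
    (M : Matrix.unitaryGroup m ℂ) {f : k → m} {g : n → m} (hf : Function.Injective f)
    (hg : Function.Injective g) : ‖M.1.submatrix f g‖ ≤ 1 := by
  have h : M.1.submatrix f g =
      ((1 : Matrix m m ℂ).submatrix id f)ᴴ * (M.1 * (1 : Matrix m m ℂ).submatrix id g) := by
    rw [Matrix.conjTranspose_submatrix, Matrix.conjTranspose_one]
    ext i j
    simp [Matrix.mul_apply, Matrix.one_apply]
  rw [h]
  refine l2_opNorm_mul_le_one ?_ (l2_opNorm_mul_le_one
    (l2_opNorm_le_one_of_conjTranspose_mul_self M.2.1) (l2_opNorm_inclusion_le hg))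
  rw [Matrix.l2_opNorm_conjTranspose]
  exact l2_opNorm_inclusion_le hf

theorem sum_norm_sq_mulVec_le {M : Matrix m n ℂ} (hM : ‖M‖ ≤ 1) (v : n → ℂ) :
    ∑ i, ‖∑ j, M i j * v j‖ ^ 2 ≤ ∑ j, ‖v j‖ ^ 2 := by
  have h := (Matrix.l2_opNorm_mulVec M (WithLp.toLp 2 v)).trans
    (mul_le_of_le_one_left (norm_nonneg _) hM)
  have h2 := pow_le_pow_left₀ (norm_nonneg _) h 2
  rw [EuclideanSpace.norm_sq_eq, EuclideanSpace.norm_sq_eq] at h2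
  exact h2

theorem sum_norm_sq_col_le {M : Matrix m n ℂ} (hM : ‖M‖ ≤ 1) (j : n) :
    ∑ i, ‖M i j‖ ^ 2 ≤ 1 := by
  have h := sum_norm_sq_mulVec_le hM (Pi.single j 1)
  simpa [Pi.single_apply, apply_ite, ite_pow] using h

theorem sum_norm_sq_row_le [DecidableEq m] {M : Matrix m n ℂ} (hM : ‖M‖ ≤ 1) (i : m) :
    ∑ j, ‖M i j‖ ^ 2 ≤ 1 := by
  have h := sum_norm_sq_col_le (M := Mᴴ) (by rwa [Matrix.l2_opNorm_conjTranspose]) i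
  simpa using h

end Contraction

/-! ### Factorization of quantum protocols. -/

namespace QProtocol

open scoped Matrix.Norms.L2Operator Matrix

variable {X Y : Type*} [Fintype X] [DecidableEq X] [Fintype Y] [DecidableEq Y]

theorem sum_norm_sq_stateAfter_le (P : QProtocol X Y) (x : X) (y : Y) (i : ℕ) :
    ∑ r, ∑ q, ∑ s, ‖P.stateAfter x y i r q s‖ ^ 2 ≤ 1 := by
  induction i with
  | zero =>
    rw [← P.amp_normalized]
    refine le_of_eq ?_
    simp only [stateAfter, initial, Fintype.sum_prod_type, Fin.sum_univ_two, apply_ite, ite_pow,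
      norm_zero]
    simp [ite_and]
  | succ i ih =>
    refine le_trans ?_ ih
    rw [stateAfter]
    split_ifs with h
    · have h1 : ∀ s, ∑ p : (X × Fin P.dim) × Fin 2,
          ‖P.applyAlice (P.alice i).1 (P.stateAfter x y i) p.1 p.2 s‖ ^ 2 ≤
          ∑ p : (X × Fin P.dim) × Fin 2, ‖P.stateAfter x y i p.1 p.2 s‖ ^ 2 := by
        intro s
        have := sum_norm_sq_mulVec_le
          (l2_opNorm_le_one_of_conjTranspose_mul_self (P.alice i).2.1)
          (fun p : (X × Fin P.dim) × Fin 2 => P.stateAfter x y i p.1 p.2 s)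
        simpa only [Fintype.sum_prod_type (γ := ℂ), applyAlice] using this
      have h2 : ∀ φ : P.State, ∑ r, ∑ q, ∑ s, ‖φ r q s‖ ^ 2 =
          ∑ s, ∑ p : (X × Fin P.dim) × Fin 2, ‖φ p.1 p.2 s‖ ^ 2 := by
        intro φ
        rw [Finset.sum_comm (γ := Y × Fin P.dim),
          Fintype.sum_prod_type (α₁ := X × Fin P.dim) (α₂ := Fin 2)]
      rw [h2, h2]
      exact Finset.sum_le_sum fun s _ => h1 s
    · refine Finset.sum_le_sum fun r _ => ?_
      have := sum_norm_sq_mulVec_le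
          (l2_opNorm_le_one_of_conjTranspose_mul_self (P.bob i).2.1)
          (fun p : Fin 2 × (Y × Fin P.dim) => P.stateAfter x y i r p.1 p.2)
      rw [Fintype.sum_prod_type, Fintype.sum_prod_type] at this
      simpa only [Fintype.sum_prod_type (γ := ℂ) (α₁ := Fin 2), applyBob] using this

theorem probNegOne_nonneg (P : QProtocol X Y) (x : X) (y : Y) : 0 ≤ P.probNegOne x y := by
  unfold probNegOne; positivity

theorem probNegOne_le_one (P : QProtocol X Y) (x : X) (y : Y) : P.probNegOne x y ≤ 1 := by
  refine le_trans (Finset.sum_le_sum fun r _ => ?_) (P.sum_norm_sq_stateAfter_le x y P.rounds)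
  exact Finset.single_le_sum (f := fun q => ∑ s, ‖P.stateAfter x y P.rounds r q s‖ ^ 2)
    (fun _ _ => by positivity) (Finset.mem_univ 1)

/-- After `i` rounds the state is a sum of `2 ^ i` local contractions applied to the entangled
state. -/
theorem exists_stateAfter_eq_sum (P : QProtocol X Y) (i : ℕ) :
    ∃ (C : Type) (_ : Fintype C) (A : C → Fin 2 → X → Matrix (X × Fin P.dim) (Fin P.dim) ℂ)
      (B : C → Fin 2 → Y → Matrix (Y × Fin P.dim) (Fin P.dim) ℂ),
      Fintype.card C = 2 ^ i ∧ (∀ c q x, ‖A c q x‖ ≤ 1) ∧ (∀ c q y, ‖B c q y‖ ≤ 1) ∧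
      ∀ x y r q s, P.stateAfter x y i r q s = ∑ c, ∑ w, P.amp w * A c q x r w * B c q y s w := by
  induction i with
  | zero =>
    -- With no history, both players just adjoin their inputs. The condition that the channel is
    -- `|0⟩` is charged to Alice alone.
    refine ⟨Unit, inferInstance,
      fun _ q x => if q = 0 then (1 : Matrix (X × Fin P.dim) (X × Fin P.dim) ℂ).submatrix id
        (fun w => (x, w)) else 0,
      fun _ _ y => (1 : Matrix (Y × Fin P.dim) (Y × Fin P.dim) ℂ).submatrix id (fun w => (y, w)),
      by simp, fun c q x => ?_, fun c q y => l2_opNorm_inclusion_le (Prod.mk_right_injective y),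
      fun x y r q s => ?_⟩
    · dsimp only
      split_ifs
      · exact l2_opNorm_inclusion_le (Prod.mk_right_injective x)
      · simp
    · obtain ⟨r, w⟩ := r
      obtain ⟨s, w'⟩ := s
      by_cases hq : q = 0
      · simp only [stateAfter, initial, hq, Finset.univ_unique, Finset.sum_singleton, if_true,
          Matrix.submatrix_apply, id, Matrix.one_apply, Prod.mk.injEq]
        rw [Finset.sum_eq_single w (fun v _ hv => by simp [Ne.symm hv]) (by simp)]
        by_cases h1 : r = x <;> by_cases h2 : s = y <;> by_cases h3 : w = w' <;>
          simp [h1, h2, h3, eq_comm]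
      · simp [stateAfter, initial, hq]
  | succ i ih =>
    obtain ⟨C, _, A, B, hC, hA, hB, h⟩ := ih
    by_cases ht : P.aliceTurn i
    -- The history records the channel bit `c.2` before the round. Alice multiplies by the block of
    -- her unitary sending `c.2` to `q`; Bob's operator stays at the old bit, whatever `q` is.
    · refine ⟨C × Fin 2, inferInstance,
        fun c q x => (P.alice i).1.submatrix (fun r => (r, q)) (fun r => (r, c.2)) * A c.1 c.2 x,
        fun c _ y => B c.1 c.2 y, by simp [hC, pow_succ], fun c q x => ?_, fun c q y => hB _ _ _,
        fun x y r q s => ?_⟩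
      · exact l2_opNorm_mul_le_one (l2_opNorm_submatrix_unitary_le _
          (Prod.mk_left_injective q) (Prod.mk_left_injective c.2)) (hA _ _ _)
      · rw [stateAfter, if_pos ht]
        simp only [applyAlice, h, Matrix.mul_apply, Matrix.submatrix_apply, Finset.mul_sum,
          Finset.sum_mul]
        rw [Fintype.sum_prod_type (α₁ := C) (α₂ := Fin 2), Finset.sum_comm (γ := C),
          Finset.sum_comm (γ := X × Fin P.dim)]
        refine Finset.sum_congr rfl fun q' _ => ?_
        rw [Finset.sum_comm]
        refine Finset.sum_congr rfl fun c _ => ?_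
        rw [Finset.sum_comm]
        exact Finset.sum_congr rfl fun w _ => Finset.sum_congr rfl fun r' _ => by ring
    · refine ⟨C × Fin 2, inferInstance, fun c _ x => A c.1 c.2 x,
        fun c q y => (P.bob i).1.submatrix (fun s => (q, s)) (fun s => (c.2, s)) * B c.1 c.2 y,
        by simp [hC, pow_succ], fun c q x => hA _ _ _, fun c q y => ?_,
        fun x y r q s => ?_⟩
      · exact l2_opNorm_mul_le_one (l2_opNorm_submatrix_unitary_le _
          (Prod.mk_right_injective q) (Prod.mk_right_injective c.2)) (hB _ _ _)
      · rw [stateAfter, if_neg ht]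
        simp only [applyBob, h, Matrix.mul_apply, Matrix.submatrix_apply, Finset.mul_sum]
        rw [Fintype.sum_prod_type, Finset.sum_comm (γ := C)]
        refine Finset.sum_congr rfl fun q' _ => ?_
        rw [Finset.sum_comm]
        refine Finset.sum_congr rfl fun c _ => ?_
        rw [Finset.sum_comm]
        exact Finset.sum_congr rfl fun w _ => Finset.sum_congr rfl fun r' _ => by ring

/-- The acceptance probability of a `t`-round protocol is a sum of `4 ^ t` inner products of
vectors of length at most one. -/
theorem exists_probNegOne_eq_sum (P : QProtocol X Y) :
    ∃ (C : Type) (_ : Fintype C) (a : C → X → Fin P.dim × Fin P.dim → ℂ)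
      (b : C → Y → Fin P.dim × Fin P.dim → ℂ),
      Fintype.card C = 4 ^ P.rounds ∧ (∀ c x, ∑ k, ‖a c x k‖ ^ 2 ≤ 1) ∧
      (∀ c y, ∑ k, ‖b c y k‖ ^ 2 ≤ 1) ∧
      ∀ x y, (P.probNegOne x y : ℂ) = ∑ c, ∑ k, a c x k * b c y k := by
  obtain ⟨C, _, A, B, hC, hA, hB, h⟩ := P.exists_stateAfter_eq_sum P.rounds
  have hM : ∀ c x, ‖(A c.2 1 x)ᴴ * A (c : C × C).1 1 x‖ ≤ 1 := fun c x =>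
    l2_opNorm_mul_le_one (by rw [Matrix.l2_opNorm_conjTranspose]; exact hA _ _ _) (hA _ _ _)
  have hN : ∀ c y, ‖(B c.2 1 y)ᴴ * B (c : C × C).1 1 y‖ ≤ 1 := fun c y =>
    l2_opNorm_mul_le_one (by rw [Matrix.l2_opNorm_conjTranspose]; exact hB _ _ _) (hB _ _ _)
  -- The squared norm pairs two histories, hence 4^t terms; summing out the final registers leaves
  -- entries of AᴴA and BᴴB. Giving the amplitude of `k.1` to Alice and that of `k.2` to Bob makes
  -- the vectors weighted averages of columns and rows of contractions, of length at most one
  -- whatever `dim` is.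
  refine ⟨C × C, inferInstance,
    fun c x k => P.amp k.1 * ((A c.2 1 x)ᴴ * A c.1 1 x) k.2 k.1,
    fun c y k => (starRingEnd ℂ) (P.amp k.2) * ((B c.2 1 y)ᴴ * B c.1 1 y) k.2 k.1, ?_,
    fun c x => ?_, fun c y => ?_, fun x y => ?_⟩
  · rw [Fintype.card_prod, hC, ← mul_pow]
    norm_num
  · rw [Fintype.sum_prod_type, ← P.amp_normalized]
    simp only [norm_mul, mul_pow, ← Finset.mul_sum]
    exact Finset.sum_le_sum fun w _ =>
      mul_le_of_le_one_right (by positivity) (sum_norm_sq_col_le (hM c x) w)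
  · rw [Fintype.sum_prod_type_right, ← P.amp_normalized]
    simp only [norm_mul, mul_pow, ← Finset.mul_sum, RCLike.norm_conj]
    exact Finset.sum_le_sum fun w _ =>
      mul_le_of_le_one_right (by positivity) (sum_norm_sq_row_le (hN c y) w)
  · have h1 : ∀ r s, ((‖P.stateAfter x y P.rounds r 1 s‖ ^ 2 : ℝ) : ℂ) =
        ∑ c : C × C, ∑ k : Fin P.dim × Fin P.dim,
          P.amp k.1 * (starRingEnd ℂ) (P.amp k.2) *
            (((starRingEnd ℂ) (A c.2 1 x r k.2) * A c.1 1 x r k.1) *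
              ((starRingEnd ℂ) (B c.2 1 y s k.2) * B c.1 1 y s k.1)) := by
      intro r s
      push_cast
      rw [← Complex.mul_conj', h]
      simp only [map_sum, map_mul, Fintype.sum_prod_type, Finset.sum_mul_sum]
      refine Finset.sum_congr rfl fun c _ => Finset.sum_congr rfl fun c' _ => ?_
      exact Finset.sum_congr rfl fun w _ => Finset.sum_congr rfl fun w' _ => by ring
    rw [probNegOne]
    push_cast only [Complex.ofReal_sum]
    simp only [h1, Matrix.mul_apply, Matrix.conjTranspose_apply]
    rw [← Fintype.sum_prod_type', Finset.sum_comm]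
    refine Finset.sum_congr rfl fun c _ => ?_
    rw [Finset.sum_comm]
    refine Finset.sum_congr rfl fun k _ => ?_
    rw [← Finset.mul_sum, Fintype.sum_prod_type]
    simp only [← Finset.mul_sum, ← Finset.sum_mul, RCLike.star_def]
    ring

end QProtocol

/-! ### Density as fibre counts, and character expansion of the composed function. -/

theorem card_fiber_le_of_isDense {ι A : Type*} [Fintype ι] [DecidableEq ι] {b : ℕ} {δ : ℝ}
    {U : Finset ((ι → Block b) × A)} {hU : U.Nonempty} (h : IsDense δ (uniformFst U hU))
    (S : Finset ι) (c : S → Block b) :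
    ((Finset.univ.filter fun u : U => (fun i : S => u.1.1 i) = c).card : ℝ) ≤
      2 ^ (-(δ * b * S.card)) * Fintype.card U := by
  classical
  have h1 := h S c
  rw [uniformFst, PMF.map_comp, ← PMF.toOuterMeasure_apply_singleton,
    PMF.toOuterMeasure_map_apply, PMF.toOuterMeasure_uniformOfFinset_apply, ENNReal.toReal_div,
    ENNReal.toReal_natCast, ENNReal.toReal_natCast,
    div_le_iff₀ (by exact_mod_cast hU.card_pos)] at h1
  rw [Fintype.card_coe]
  refine le_trans (le_of_eq ?_) h1
  rw [Nat.cast_inj, ← Finset.card_map (Function.Embedding.subtype (· ∈ U))]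
  congr 1
  ext u
  simp [and_comm]

/-- Since `r ^ |S| = (n r) ^ |S| · n ^ (-|S|)`, the factor `(n r) ^ d` comes out when `|S| ≥ d`, and
the rest sums to at most `(1 + 1/n) ^ n ≤ e < 3`. -/
theorem sum_pow_card_le {ι : Type*} [Fintype ι] {n d : ℕ} (hn : Fintype.card ι ≤ n) {r : ℝ}
    (hr : 0 ≤ r) (hnr : n * r ≤ 1) :
    ∑ S : Finset ι with d ≤ S.card, r ^ S.card ≤ 3 * (n * r) ^ d := by
  rcases Nat.eq_zero_or_pos n with rfl | hn0
  · have hE : IsEmpty ι := Fintype.card_eq_zero_iff.mp (by omega)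
    rw [Finset.sum_filter]
    rcases Nat.eq_zero_or_pos d with rfl | hd
    · simp [Finset.eq_empty_of_isEmpty]
    · simp [Finset.eq_empty_of_isEmpty, hd.ne']
  have hn1 : (0 : ℝ) < n := by exact_mod_cast hn0
  calc ∑ S : Finset ι with d ≤ S.card, r ^ S.card
      ≤ ∑ S : Finset ι with d ≤ S.card, (n * r) ^ d * (1 / n : ℝ) ^ S.card := by
        refine Finset.sum_le_sum fun S hS => ?_
        rw [show r = (n * r) * (1 / n : ℝ) by field_simp, mul_pow]
        rw [show (n : ℝ) * (n * r * (1 / n)) = n * r by field_simp]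
        gcongr ?_ * _
        exact pow_le_pow_of_le_one (by positivity) hnr (Finset.mem_filter.mp hS).2
    _ ≤ ∑ S : Finset ι, (n * r) ^ d * (1 / n : ℝ) ^ S.card :=
        Finset.sum_le_sum_of_subset_of_nonneg (Finset.filter_subset _ _)
          fun _ _ _ => by positivity
    _ = (n * r) ^ d * (1 + 1 / n : ℝ) ^ Fintype.card ι := by
        rw [← Finset.mul_sum, add_comm (1 : ℝ), ← Fintype.sum_pow_mul_eq_add_pow]
        simp
    _ ≤ (n * r) ^ d * 3 := by
        gcongr
        calc (1 + 1 / n : ℝ) ^ Fintype.card ι ≤ (1 + 1 / n : ℝ) ^ n :=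
              pow_le_pow_right₀ (by simp) hn
          _ ≤ Real.exp (1 / n) ^ n := by
              gcongr
              rw [add_comm]
              exact Real.add_one_le_exp _
          _ = Real.exp 1 := by rw [← Real.exp_nat_mul]; field_simp
          _ ≤ 3 := by linarith [Real.exp_one_lt_d9]
    _ = 3 * (n * r) ^ d := mul_comm _ _

section Expansion

variable {ι α β : Type*} [Fintype ι] [DecidableEq ι] [Fintype α] [Fintype β]

/-- If the characters `χ_S` of `z` have correlation at most `r ^ |S| * M` with the kernel `k`,
then the correlation of `g ∘ z` with the kernel is determined by the low levels of `g`. -/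
theorem norm_sum_sub_lowDegree_le {n d : ℕ} (hn : Fintype.card ι ≤ n) {r M : ℝ} (hr : 0 ≤ r)
    (hM : 0 ≤ M) (hnr : n * r ≤ 1) (z : α → β → ι → ZMod 2) (k : α → β → ℂ)
    (hk : ∀ S : Finset ι, ‖∑ u, ∑ v, (chi S (z u v) : ℂ) * k u v‖ ≤ r ^ S.card * M)
    (g : (ι → ZMod 2) → ℝ) :
    ‖2 ^ Fintype.card ι * ∑ u, ∑ v, (g (z u v) : ℂ) * k u v -
      ∑ S : Finset ι with S.card < d, ((∑ x, g x * chi S x : ℝ) : ℂ) *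
        ∑ u, ∑ v, (chi S (z u v) : ℂ) * k u v‖ ≤ 3 * (n * r) ^ d * (∑ x, |g x|) * M := by
  -- Fourier inversion of `g` at `z u v`; the factor `2 ^ |ι|` stands in for the normalization of
  -- the coefficients.
  have h1 : 2 ^ Fintype.card ι * ∑ u, ∑ v, (g (z u v) : ℂ) * k u v =
      ∑ S : Finset ι, ((∑ x, g x * chi S x : ℝ) : ℂ) *
        ∑ u, ∑ v, (chi S (z u v) : ℂ) * k u v := by
    simp only [Finset.mul_sum]
    rw [Finset.sum_comm (γ := Finset ι)]
    refine Finset.sum_congr rfl fun u _ => ?_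
    rw [Finset.sum_comm (γ := Finset ι)]
    refine Finset.sum_congr rfl fun v _ => ?_
    have h2 := congrArg Complex.ofReal (sum_chi_mul_sum g (z u v))
    rw [Complex.ofReal_mul, Complex.ofReal_sum] at h2
    rw [← mul_assoc, show (2 : ℂ) ^ Fintype.card ι = ((2 ^ Fintype.card ι : ℝ) : ℂ) by push_cast; rfl,
      ← h2, Finset.sum_mul]
    exact Finset.sum_congr rfl fun S _ => by rw [Complex.ofReal_mul, mul_assoc]
  have hg : ∀ S : Finset ι, ‖((∑ x, g x * chi S x : ℝ) : ℂ)‖ ≤ ∑ x, |g x| := by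
    intro S
    rw [Complex.norm_real, Real.norm_eq_abs]
    refine (Finset.abs_sum_le_sum_abs _ _).trans_eq ?_
    exact Finset.sum_congr rfl fun x _ => by rw [abs_mul, abs_chi, mul_one]
  have hg0 : 0 ≤ ∑ x, |g x| := Finset.sum_nonneg fun _ _ => abs_nonneg _
  rw [h1, ← Finset.sum_filter_add_sum_filter_not Finset.univ fun S : Finset ι => S.card < d,
    add_sub_cancel_left]
  simp only [not_lt]
  calc _ ≤ ∑ S : Finset ι with d ≤ S.card, (∑ x, |g x|) * (r ^ S.card * M) := by
        refine (norm_sum_le _ _).trans (Finset.sum_le_sum fun S _ => ?_)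
        rw [norm_mul]
        exact mul_le_mul (hg S) (hk S) (norm_nonneg _) hg0
    _ = (∑ S : Finset ι with d ≤ S.card, r ^ S.card) * ((∑ x, |g x|) * M) := by
        rw [Finset.sum_mul]
        exact Finset.sum_congr rfl fun S _ => by ring
    _ ≤ (3 * (n * r) ^ d) * ((∑ x, |g x|) * M) := by
        gcongr
        exact sum_pow_card_le hn hr hnr
    _ = _ := by ring

theorem norm_sum_le_of_orthogonal {n d : ℕ} (hn : Fintype.card ι ≤ n) {r M : ℝ} (hr : 0 ≤ r)
    (hM : 0 ≤ M) (hnr : n * r ≤ 1) (z : α → β → ι → ZMod 2) (k : α → β → ℂ)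
    (hk : ∀ S : Finset ι, ‖∑ u, ∑ v, (chi S (z u v) : ℂ) * k u v‖ ≤ r ^ S.card * M)
    (g : (ι → ZMod 2) → ℝ) (hg : ∀ S : Finset ι, S.card < d → ∑ x, g x * chi S x = 0) :
    ‖2 ^ Fintype.card ι * ∑ u, ∑ v, (g (z u v) : ℂ) * k u v‖ ≤
      3 * (n * r) ^ d * (∑ x, |g x|) * M := by
  have h := norm_sum_sub_lowDegree_le (d := d) hn hr hM hnr z k hk g
  rwa [Finset.sum_eq_zero (s := Finset.univ.filter fun S : Finset ι => S.card < d) fun S hS => by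
    rw [hg S (Finset.mem_filter.mp hS).2, Complex.ofReal_zero, zero_mul], sub_zero] at h

/-- If the characters of `z` have small averages, then `z` is close to uniform. -/
theorem abs_sum_sub_le_of_small_bias {n : ℕ} (hn : Fintype.card ι ≤ n) {r M : ℝ} (hr : 0 ≤ r)
    (hM : 0 ≤ M) (hnr : n * r ≤ 1) (z : α → β → ι → ZMod 2)
    (hk : ∀ S : Finset ι, ‖∑ u, ∑ v, (chi S (z u v) : ℂ) * 1‖ ≤ r ^ S.card * M)
    (g : (ι → ZMod 2) → ℝ) :
    |2 ^ Fintype.card ι * ∑ u, ∑ v, g (z u v) -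
      (∑ x, g x) * (Fintype.card α * Fintype.card β)| ≤ 3 * (n * r) * (∑ x, |g x|) * M := by
  have h := norm_sum_sub_lowDegree_le (d := 1) hn hr hM hnr z (fun _ _ => 1) hk g
  -- With `d = 1` only the empty character is split off, and it contributes the uniform average.
  rw [show (Finset.univ.filter fun S : Finset ι => S.card < 1) = {∅} by ext S; simp,
    Finset.sum_singleton, pow_one] at h
  refine le_trans (le_of_eq ?_) h
  rw [← Real.norm_eq_abs, ← Complex.norm_real]
  push_cast
  simp [chi]

end Expansion

/-- The correlation bound for pairs of `0.99`-dense sources, with `r = 2 ^ (-0.49 b)`. -/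
theorem norm_sum_chi_innerGadget_le_of_dense {ι α β K : Type*} [Fintype α] [Fintype β]
    [DecidableEq ι] [Fintype K] {b : ℕ} (S : Finset ι) (x : α → ι → Block b) (y : β → ι → Block b)
    (hx : ∀ c : S → Block b, ((Finset.univ.filter fun u => (fun i : S => x u i) = c).card : ℝ) ≤
      2 ^ (-(0.99 * (b : ℝ) * S.card)) * Fintype.card α)
    (hy : ∀ c : S → Block b, ((Finset.univ.filter fun v => (fun i : S => y v i) = c).card : ℝ) ≤
      2 ^ (-(0.99 * (b : ℝ) * S.card)) * Fintype.card β)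
    (a : α → K → ℂ) (ha : ∀ u, ∑ k, ‖a u k‖ ^ 2 ≤ 1)
    (c : β → K → ℂ) (hc : ∀ v, ∑ k, ‖c v k‖ ^ 2 ≤ 1) :
    ‖∑ u, ∑ v, (chi S (innerGadget (x u) (y v)) : ℂ) * ∑ k, a u k * c v k‖ ≤
      ((2 : ℝ) ^ (-(0.49 * (b : ℝ)))) ^ S.card * (Fintype.card α * Fintype.card β) := by
  have h := norm_sum_chi_innerGadget_le S x y (by positivity) hx hy a ha c hc
  refine le_of_sq_le_sq (h.trans_eq ?_) (by positivity)
  have h2 : (2 : ℝ) ^ (b * S.card) * ((2 : ℝ) ^ (-(0.99 * (b : ℝ) * S.card))) ^ 2 =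
      (((2 : ℝ) ^ (-(0.49 * (b : ℝ)))) ^ S.card) ^ 2 := by
    simp only [← Real.rpow_natCast, ← Real.rpow_mul (zero_le_two (α := ℝ)),
      ← Real.rpow_add (zero_lt_two (α := ℝ))]
    congr 1
    push_cast
    ring
  rw [mul_assoc ((2 : ℝ) ^ (-(0.99 * (b : ℝ) * S.card))), mul_pow, ← mul_assoc, h2, ← mul_pow]

/-! ### Comparison of the two correlation bounds. -/

/-- A protocol for the composed function on dense sources needs many rounds. -/
theorem le_pow_rounds_mul_of_computes {ι α β : Type*} [Fintype ι] [DecidableEq ι]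
    [Fintype α] [DecidableEq α] [Nonempty α] [Fintype β] [DecidableEq β] [Nonempty β] {b n : ℕ}
    (hn : Fintype.card ι ≤ n) (x : α → ι → Block b) (y : β → ι → Block b)
    (hx : ∀ (S : Finset ι) (c : S → Block b),
      ((Finset.univ.filter fun u => (fun i : S => x u i) = c).card : ℝ) ≤
        2 ^ (-(0.99 * (b : ℝ) * S.card)) * Fintype.card α)
    (hy : ∀ (S : Finset ι) (c : S → Block b),
      ((Finset.univ.filter fun v => (fun i : S => y v i) = c).card : ℝ) ≤
        2 ^ (-(0.99 * (b : ℝ) * S.card)) * Fintype.card β)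
    (hb : n * (2 : ℝ) ^ (-(0.49 * (b : ℝ))) ≤ 0.001) (f : (ι → ZMod 2) → ℤˣ)
    (hd : 0 < approxDegree (1 / 3) fun z => ((f z : ℤ) : ℝ))
    (P : QProtocol α β) (hP : P.Computes (fun u v => f (innerGadget (x u) (y v))) 0.1) :
    0.12 ≤ 9 * 4 ^ P.rounds * (n * (2 : ℝ) ^ (-(0.49 * (b : ℝ)))) ^
      approxDegree (1 / 3) fun z => ((f z : ℤ) : ℝ) := by
  -- Duality through an open ball needs a value strictly below 1/3.
  obtain ⟨ψ, hψ, hψ0, hψf⟩ := exists_dual_polynomial (r := 0.33) (by norm_num) (by norm_num) _ hd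
  set d := approxDegree (1 / 3) fun z => ((f z : ℤ) : ℝ)
  set r := (2 : ℝ) ^ (-(0.49 * (b : ℝ))) with hr
  have hr0 : 0 ≤ r := by positivity
  set N := ∑ z, |ψ z| with hN
  set M : ℝ := Fintype.card α * Fintype.card β with hM
  have hM0 : 0 < M := by
    have h1 : (0 : ℝ) < Fintype.card α := by exact_mod_cast Fintype.card_pos
    have h2 : (0 : ℝ) < Fintype.card β := by exact_mod_cast Fintype.card_pos
    positivity
  have hnr : n * r ≤ 1 := hb.trans (by norm_num)
  set z : α → β → ι → ZMod 2 := fun u v => innerGadget (x u) (y v) with hz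
  have hone : ∀ S : Finset ι, ‖∑ u, ∑ v, (chi S (z u v) : ℂ) * 1‖ ≤ r ^ S.card * M := by
    intro S
    simpa using norm_sum_chi_innerGadget_le_of_dense (K := Unit) S x y (hx S) (hy S)
      (fun _ _ => 1) (by simp) (fun _ _ => 1) (by simp)
  have h1 := (abs_le.mp (abs_sum_sub_le_of_small_bias hn hr0 hM0.le hnr z hone
    fun w => ψ w * ((f w : ℤ) : ℝ))).1
  have h2 := (abs_le.mp (abs_sum_sub_le_of_small_bias hn hr0 hM0.le hnr z hone
    fun w => |ψ w|)).2
  have hfabs : ∀ w, |((f w : ℤ) : ℝ)| = 1 := by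
    intro w
    rcases Int.units_eq_one_or (f w) with h | h <;> simp [h]
  simp only [abs_mul, hfabs, mul_one, abs_abs, ← hM, ← hN] at h1 h2
  have h3 := norm_sum_le_of_orthogonal hn hr0 hM0.le hnr z (fun _ _ => 1) hone ψ hψ
  have h4 : ‖(2 : ℂ) ^ Fintype.card ι * ∑ u, ∑ v, (ψ (z u v) : ℂ) * (P.probNegOne u v : ℂ)‖ ≤
      4 ^ P.rounds * (3 * (n * r) ^ d * N * M) := by
    obtain ⟨C, _, a, c, hC, ha, hc, h⟩ := P.exists_probNegOne_eq_sum
    have h5 : (2 : ℂ) ^ Fintype.card ι * ∑ u, ∑ v, (ψ (z u v) : ℂ) * (P.probNegOne u v : ℂ) =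
        ∑ i : C, (2 : ℂ) ^ Fintype.card ι * ∑ u, ∑ v, (ψ (z u v) : ℂ) *
          ∑ k, a i u k * c i v k := by
      rw [← Finset.mul_sum, Finset.sum_comm (γ := C)]
      congr 1
      refine Finset.sum_congr rfl fun u _ => ?_
      rw [Finset.sum_comm (γ := C)]
      exact Finset.sum_congr rfl fun v _ => by rw [h, Finset.mul_sum]
    rw [h5]
    refine (norm_sum_le_of_le _ fun i _ => norm_sum_le_of_orthogonal hn hr0 hM0.le hnr z
      (fun u v => ∑ k, a i u k * c i v k) (fun S => norm_sum_chi_innerGadget_le_of_dense S x y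
        (hx S) (hy S) (a i) (ha i) (c i) (hc i)) ψ hψ).trans_eq ?_
    simp [hC, ← hN]
  have h3' : -(3 * (n * r) ^ d * N * M) ≤ 2 ^ Fintype.card ι * ∑ u, ∑ v, ψ (z u v) ∧
      2 ^ Fintype.card ι * ∑ u, ∑ v, ψ (z u v) ≤ 3 * (n * r) ^ d * N * M := by
    rw [← abs_le, ← Real.norm_eq_abs, ← Complex.norm_real]
    push_cast
    simpa using h3
  have h4' : -(4 ^ P.rounds * (3 * (n * r) ^ d * N * M)) ≤
      2 ^ Fintype.card ι * ∑ u, ∑ v, ψ (z u v) * P.probNegOne u v := by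
    refine (abs_le.mp ?_).1
    rw [← Real.norm_eq_abs, ← Complex.norm_real]
    push_cast
    exact h4
  -- The expected output `1 - 2 * probNegOne` differs from `f` by at most 0.2, twice the error
  -- probability.
  have hpt : ∀ u v, ψ (z u v) * ((f (z u v) : ℤ) : ℝ) ≤
      ψ (z u v) - 2 * (ψ (z u v) * P.probNegOne u v) + 0.2 * |ψ (z u v)| := by
    intro u v
    have hc := hP u v
    have hp0 := P.probNegOne_nonneg u v
    have hp1 := P.probNegOne_le_one u v
    have hdiff : |((f (z u v) : ℤ) : ℝ) - (1 - 2 * P.probNegOne u v)| ≤ 0.2 := by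
      rw [QProtocol.outputProb] at hc
      change 1 - 0.1 ≤ if f (z u v) = -1 then _ else _ at hc
      rcases Int.units_eq_one_or (f (z u v)) with h | h
      · rw [h, if_neg (by decide)] at hc
        rw [h, abs_le]
        push_cast
        constructor <;> linarith
      · rw [h, if_pos rfl] at hc
        rw [h, abs_le]
        push_cast
        constructor <;> linarith
    have h6 := (le_abs_self (ψ (z u v) * (((f (z u v) : ℤ) : ℝ) - (1 - 2 * P.probNegOne u v)))).trans
      ((abs_mul _ _).trans_le (mul_le_mul_of_nonneg_left hdiff (abs_nonneg _)))
    linarith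
  have hsum : 2 ^ Fintype.card ι * ∑ u, ∑ v, ψ (z u v) * ((f (z u v) : ℤ) : ℝ) ≤
      2 ^ Fintype.card ι * ∑ u, ∑ v, ψ (z u v) -
        2 * (2 ^ Fintype.card ι * ∑ u, ∑ v, ψ (z u v) * P.probNegOne u v) +
        0.2 * (2 ^ Fintype.card ι * ∑ u, ∑ v, |ψ (z u v)|) := by
    have := mul_le_mul_of_nonneg_left (Finset.sum_le_sum fun u (_ : u ∈ Finset.univ) =>
      Finset.sum_le_sum fun v (_ : v ∈ Finset.univ) => hpt u v)
      (by positivity : (0 : ℝ) ≤ 2 ^ Fintype.card ι)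
    refine this.trans_eq ?_
    simp only [Finset.sum_add_distrib, Finset.sum_sub_distrib, ← Finset.mul_sum]
    ring
  have hNM : 0 < N * M := mul_pos hψ0 hM0
  have h7 : 0.33 * (N * M) ≤ (∑ w, ψ w * ((f w : ℤ) : ℝ)) * M := by
    rw [← mul_assoc]
    exact mul_le_mul_of_nonneg_right hψf hM0.le
  have h8 : 3 * (n * r) * N * M ≤ 0.003 * (N * M) := by
    rw [mul_assoc]
    gcongr
    linarith
  have h9 : 3 * (n * r) ^ d * N * M ≤ 4 ^ P.rounds * (3 * (n * r) ^ d * N * M) :=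
    le_mul_of_one_le_left (by positivity) (one_le_pow₀ (by norm_num))
  -- The margin is 0.33 - 0.003 - 0.2 · 1.003 > 0.12. The terms for `1` and `2 * probNegOne`
  -- contribute one and two copies of the upper bound, hence 9 = 3 · 3.
  refine le_of_mul_le_mul_right ?_ hNM
  have h10 : 9 * 4 ^ P.rounds * (n * r) ^ d * (N * M) =
      3 * (4 ^ P.rounds * (3 * (n * r) ^ d * N * M)) := by ring
  rw [h10]
  linarith [h3'.2]

/-! ### Numerical estimates and conclusion. -/

/-- As log n < (b + 1)/20, the exponent is at most 0.05b + 0.05 - 0.49b. The value 119 is 20 log 64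
- 1. -/
theorem card_mul_two_rpow_le {n b : ℕ} (hn : 64 ≤ n)
    (hb : |(b : ℝ) - 20 * Real.logb 2 (n : ℝ)| < 1) :
    119 ≤ (b : ℝ) ∧ n * (2 : ℝ) ^ (-(0.49 * (b : ℝ))) ≤ 2 ^ (-(0.43 * (b : ℝ))) := by
  obtain ⟨h1, h2⟩ := abs_lt.mp hb
  have hn0 : (0 : ℝ) < n := by exact_mod_cast (by omega : 0 < n)
  have h6 : 6 ≤ Real.logb 2 (n : ℝ) := by
    rw [Real.le_logb_iff_rpow_le one_lt_two hn0]
    calc (2 : ℝ) ^ (6 : ℝ) = 64 := by norm_num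
      _ ≤ n := by exact_mod_cast hn
  refine ⟨by linarith, ?_⟩
  nth_rewrite 1 [← Real.rpow_logb zero_lt_two (by norm_num) hn0]
  rw [← Real.rpow_add zero_lt_two]
  refine Real.rpow_le_rpow_of_exponent_le one_le_two ?_
  linarith

theorem rounds_ge_of_le {b d t : ℕ} (hb : 119 ≤ (b : ℝ)) (hd : 0 < d)
    (h : 0.12 ≤ 9 * 4 ^ t * ((2 : ℝ) ^ (-(0.43 * (b : ℝ)))) ^ d) : 0.1 * (d : ℝ) * b ≤ t := by
  have h1 : (0.12 : ℝ) / 9 ≤ 2 ^ (2 * (t : ℝ) - 0.43 * b * d) := by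
    have h2 : (4 : ℝ) ^ t * ((2 : ℝ) ^ (-(0.43 * (b : ℝ)))) ^ d =
        2 ^ (2 * (t : ℝ) - 0.43 * b * d) := by
      rw [show (4 : ℝ) = 2 ^ (2 : ℝ) by norm_num]
      simp only [← Real.rpow_natCast, ← Real.rpow_mul (zero_le_two (α := ℝ)),
        ← Real.rpow_add (zero_lt_two (α := ℝ))]
      congr 1
      ring
    rw [← h2]
    linarith
  -- As 0.12/9 > 2^{-7}, this gives t ≥ 0.215bd - 3.5, and the constant is absorbed because bd ≥
  -- 119.
  have h3 : (2 : ℝ) ^ (-7 : ℝ) ≤ 2 ^ (2 * (t : ℝ) - 0.43 * b * d) := by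
    refine le_trans ?_ h1
    rw [Real.rpow_neg zero_le_two]
    norm_num
  rw [Real.rpow_le_rpow_left_iff one_lt_two] at h3
  have hd1 : (1 : ℝ) ≤ d := by exact_mod_cast hd
  nlinarith [mul_le_mul hb hd1 zero_le_one (by linarith)]

end DenseLift

theorem mainTheorem3 :
    ∃ c : ℝ, 0 < c ∧ ∃ n₀ : ℕ, ∀ n : ℕ, n₀ ≤ n →
      ∀ b : ℕ, |(b : ℝ) - 20 * Real.logb 2 (n : ℝ)| < 1 →
      ∀ (J : Finset (Fin n)) (l : ℕ)
        (U V : Finset ((J → DenseLift.Block b) × (Fin l → ZMod 2)))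
        (hU : U.Nonempty) (hV : V.Nonempty)
        (f : (J → ZMod 2) → ℤˣ),
        DenseLift.IsDense 0.99 (DenseLift.uniformFst U hU) →
        DenseLift.IsDense 0.99 (DenseLift.uniformFst V hV) →
        ENNReal.ofReal
            (c * (DenseLift.approxDegree (1 / 3) (fun z => ((f z : ℤ) : ℝ)) : ℝ) * (b : ℝ)) ≤
          ((DenseLift.quantumCC 0.1 (DenseLift.composedOn f U V) : ℕ∞) : ENNReal) := by
  refine ⟨0.1, by norm_num, 64, fun n hn b hb J l U V hU hV f hUd hVd => ?_⟩
  obtain ⟨hb1, hb2⟩ := DenseLift.card_mul_two_rpow_le hn hb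
  set d := DenseLift.approxDegree (1 / 3) fun z => ((f z : ℤ) : ℝ) with hd
  rcases Nat.eq_zero_or_pos d with h0 | hpos
  · simp [h0]
  have hsmall : (2 : ℝ) ^ (-(0.43 * (b : ℝ))) ≤ 0.001 := by
    calc (2 : ℝ) ^ (-(0.43 * (b : ℝ))) ≤ 2 ^ (-10 : ℝ) :=
          Real.rpow_le_rpow_of_exponent_le one_le_two (by linarith)
      _ ≤ 0.001 := by rw [Real.rpow_neg zero_le_two]; norm_num
  -- Rounding up is harmless because costs are integers, and it lets the infimum be bounded within
  -- `ℕ∞`.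
  have key : ((⌈0.1 * (d : ℝ) * b⌉₊ : ℕ) : ℕ∞) ≤
      DenseLift.quantumCC 0.1 (DenseLift.composedOn f U V) := by
    refine le_iInf₂ fun P hP => ?_
    rw [Nat.cast_le, Nat.ceil_le]
    have : Nonempty U := hU.to_subtype
    have : Nonempty V := hV.to_subtype
    have h := DenseLift.le_pow_rounds_mul_of_computes (n := n)
      (by simpa using Finset.card_le_univ J)
      (fun u : U => u.1.1) (fun v : V => v.1.1) (DenseLift.card_fiber_le_of_isDense hUd)
      (DenseLift.card_fiber_le_of_isDense hVd) (hb2.trans hsmall) f hpos P hP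
    refine DenseLift.rounds_ge_of_le hb1 hpos (h.trans ?_)
    gcongr
  calc ENNReal.ofReal (0.1 * (d : ℝ) * b) ≤ ((⌈0.1 * (d : ℝ) * b⌉₊ : ℕ) : ENNReal) := by
        rw [← ENNReal.ofReal_natCast]
        exact ENNReal.ofReal_le_ofReal (Nat.le_ceil _)
    _ ≤ _ := by exact_mod_cast ENat.toENNReal_le.mpr key
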